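/- **Setting.** Let $<$ be a total order on the variables $x_1,\dots,x_n$. An $\mathrm{OBDD}_<$ is a rooted directed acyclic graph with two terminals $\bot,\top$. Every non-terminal node $v$ has a label $\mathrm{var}(v)\in\{x_1,\dots,x_n\}$ and two children $\mathrm{lo}(v),\mathrm{hi}(v)$, and labels strictly increase with respect to $<$ along edges between non-terminal nodes. It represents the function $f_R$ of its root $R$, where $f_\bot=0$, $f_\top=1$ and $f_v=(\neg\mathrm{var}(v)\wedge f_{\mathrm{lo}(v)})\vee(\mathrm{var}(v)\wedge f_{\mathrm{hi}(v)})$. Its size $|B|$ is its number of nodes (terminals included), and $V(B)$ is the set of labels that occur in $B$. An OBDD is *level-wise smooth* with respect to a set $V$ of variables if all labels lie in $V$ and no edge leaving a non-terminal node skips a variable of $V$ (for every edge $v\to c$ no $x\in V$ satisfies $\mathrm{var}(v)<x<\mathrm{var}(c)$, where a terminal counts as lying after all variables). A $\mathrm{TT}_<$ representation of an $n$-ary Boolean function $f$ consists of a number $m\ge 1$, tensors $\mathcal A_i$ of dimensions $r_i\times 2\times r_{i+1}$ ($1\le i\le m$, $r_i\ge 1$, $r_1=r_{m+1}=1$) with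 entries in $\{-1,0,1\}$, and a map $\pi:\{1,\dots,m\}\to\{1,\dots,n\}$ with $x_{\pi(i)}<x_{\pi(j)}$ for $i<j$, such that the tensor with entries $\mathcal A_1(\cdot,a_1,\cdot)\cdots\mathcal A_m(\cdot,a_m,\cdot)$ has all entries in $\{0,1\}$ and $f(x)=\mathcal A_1(\cdot,x_{\pi(1)},\cdot)\cdots\mathcal A_m(\cdot,x_{\pi(m)},\cdot)$ for all $x\in\{0,1\}^n$. Its size is $\sum_{i=1}^m 2r_ir_{i+1}$ and its rank is $\max_i r_i$. For two classes $A,B$ of representations of Boolean functions with at least one variable, $A$ is *at least as succinct as* $B$ if there is a polynomial $p$ such that every $\beta\in B$ has an equivalent $\alpha\in A$ with $|\alpha|\le p(|\beta|)$; $A$ is *more succinct than* $B$ if, in addition, $B$ is not at least as succinct as $A$. The hidden weighted bit function is $\mathrm{HWB}_n(x)=x_{\sum_i x_i}$ for $x\neq 0$, and $\mathrm{HWB}_n(0)=0$. **Theorem.** Fix, for every $n$, a total order $<$ on $x_1,\dots,x_n$. Then $\mathrm{TT}_<$ is more succinct than $\mathrm{OBDD}_<$. More precisely, for every $n$ and every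 total order $<$ on $x_1,\dots,x_n$: 1. Every $\mathrm{OBDD}_<$ $B$ is equivalent to an $\mathrm{OBDD}_<$ $L$ that is level-wise smooth with respect to $V(B)$ and has size $|L|\le |B|\cdot\max(1,|V(B)|)$. 2. If $n\ge1$, every $\mathrm{OBDD}_<$ $L$ that is level-wise smooth with respect to some set of variables is equivalent to a $\mathrm{TT}_<$ of size at most $|L|^2$. (So every $\mathrm{OBDD}_<$ $B$ has an equivalent $\mathrm{TT}_<$ of size polynomial in $|B|$.) 3. If $n\ge1$, $\mathrm{HWB}_n$ has a $\mathrm{TT}_<$ representation of rank at most $2n$ and of size at most $8n^3$. 4. Every $\mathrm{OBDD}_<$ representing $\mathrm{HWB}_n$ has size at least $c\,2^{n/5}$, where $c>0$ is a constant that depends neither on $n$ nor on $<$. -/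

import Mathlib

/-! ### Boolean functions and variable orders -/

/-- An `n`-ary Boolean function; the variable `x_{i+1}` is the coordinate `i : Fin n`. -/
abbrev BoolFun (n : ℕ) : Type := (Fin n → Bool) → Bool

/-- A total order `<` among the variables `x_1, …, x_n`. -/
structure VarOrder (n : ℕ) where
  lt : Fin n → Fin n → Prop
  isOrder : IsStrictTotalOrder (Fin n) lt

/-! ### Ordered binary decision diagrams -/

/-- An OBDD over `x_1, …, x_n` that follows the variable order `ord`. The nodes are the
non-terminal nodes `Sum.inl v` and the two terminals `⊥ = Sum.inr false`, `⊤ = Sum.inr true`.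
Labels strictly increase along every edge between non-terminal nodes, hence from every
non-terminal node to each of its non-terminal descendants, so that the graph is acyclic; and every
non-terminal node can be reached from the root. -/
structure OBDD {n : ℕ} (ord : VarOrder n) where
  /-- the non-terminal nodes -/
  Node : Type
  [fintypeNode : Fintype Node]
  root : Node ⊕ Bool
  var : Node → Fin n
  lo : Node → Node ⊕ Bool
  hi : Node → Node ⊕ Bool
  ordered : ∀ v c : Node, lo v = Sum.inl c ∨ hi v = Sum.inl c → ord.lt (var v) (var c)
  rooted : ∀ u : Node, ∃ r : Node, root = Sum.inl r ∧
    Relation.ReflTransGen (fun v c : Node => lo v = Sum.inl c ∨ hi v = Sum.inl c) r u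

namespace OBDD

variable {n : ℕ} {ord : VarOrder n}

/-- The size: the number of nodes, the two terminals included. -/
def size (B : OBDD ord) : ℕ :=
  letI := B.fintypeNode
  Fintype.card B.Node + 2

/-- `V(B)`, the set of the labels that occur in `B`. -/
def labels (B : OBDD ord) : Set (Fin n) := Set.range B.var

/-- A bound for the length of the paths below a node, used only for the termination of `eval`:
one more than the number of variables after the label. -/
noncomputable def height (B : OBDD ord) : B.Node ⊕ Bool → ℕ
  | Sum.inr _ => 0
  | Sum.inl v => Set.ncard {x : Fin n | ord.lt (B.var v) x} + 1

theorem height_lt (B : OBDD ord) (v : B.Node) (u : B.Node ⊕ Bool)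
    (hu : B.lo v = u ∨ B.hi v = u) : B.height u < B.height (Sum.inl v) := by
  have := ord.isOrder
  rcases u with c | b
  · have hvc := B.ordered v c hu
    simp only [height]
    refine Nat.add_lt_add_right (Set.ncard_lt_ncard ?_ (Set.toFinite _)) 1
    refine ⟨fun x hx => _root_.trans hvc hx, fun h => ?_⟩
    exact irrefl (r := ord.lt) (B.var c) (h hvc)
  · simp [height]

/-- The Boolean function `f_u` of a node `u`, evaluated at the assignment `x`. -/
noncomputable def eval (B : OBDD ord) (x : Fin n → Bool) : B.Node ⊕ Bool → Bool
  | Sum.inr b => b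
  | Sum.inl v =>
      (!(x (B.var v)) && B.eval x (B.lo v)) || (x (B.var v) && B.eval x (B.hi v))
  termination_by u => B.height u
  decreasing_by
    · exact B.height_lt v _ (Or.inl rfl)
    · exact B.height_lt v _ (Or.inr rfl)

/-- The Boolean function represented by `B`: the function of its root. -/
noncomputable def fn (B : OBDD ord) : BoolFun n := fun x => B.eval x B.root

/-- `B` is level-wise smooth with respect to the set `V` of variables: every label lies in `V`, and
no edge skips a variable of `V` (an edge to a terminal skips all the variables of `V` after the
label of its source). -/
def IsLevelwiseSmooth (B : OBDD ord) (V : Set (Fin n)) : Prop :=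
  ∀ v : B.Node, B.var v ∈ V ∧
    (∀ c : B.Node, B.lo v = Sum.inl c ∨ B.hi v = Sum.inl c →
      ¬ ∃ x ∈ V, ord.lt (B.var v) x ∧ ord.lt x (B.var c)) ∧
    (∀ b : Bool, B.lo v = Sum.inr b ∨ B.hi v = Sum.inr b →
      ¬ ∃ x ∈ V, ord.lt (B.var v) x)

end OBDD

/-! ### Tensor trains -/

/-- A tensor train `A_1, …, A_m` with integer entries for a `2 × ⋯ × 2` tensor with `m` modes. With
`i : Fin m` for the index `i + 1`, the tensor `A_{i+1}` has dimensions `r i × 2 × r (i+1)` and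
`core i b` is its slice `A_{i+1}(·, b, ·)`. -/
structure TensorTrain (m : ℕ) where
  r : Fin (m + 1) → ℕ
  r_pos : ∀ i, 0 < r i
  r_first : r 0 = 1
  r_last : r (Fin.last m) = 1
  core : (i : Fin m) → Bool → Matrix (Fin (r i.castSucc)) (Fin (r i.succ)) ℤ

namespace TensorTrain

variable {m : ℕ}

/-- The matrix product `A_1(·, a_1, ·) ⋯ A_i(·, a_i, ·)`. -/
def partialProduct (T : TensorTrain m) (a : Fin m → Bool) (i : Fin (m + 1)) :
    Matrix (Fin (T.r 0)) (Fin (T.r i)) ℤ :=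
  Fin.induction (motive := fun i => Matrix (Fin (T.r 0)) (Fin (T.r i)) ℤ)
    1 (fun i M => M * T.core i (a i)) i

/-- The entry `(a_1, …, a_m)` of the tensor `A_1 ⋯ A_m`: the only entry of the `1 × 1` matrix
`A_1(·, a_1, ·) ⋯ A_m(·, a_m, ·)`. -/
def entry (T : TensorTrain m) (a : Fin m → Bool) : ℤ :=
  T.partialProduct a (Fin.last m) ⟨0, T.r_pos 0⟩ ⟨0, T.r_pos (Fin.last m)⟩

/-- The size: the total number of the elements of `A_1, …, A_m`. -/
def size (T : TensorTrain m) : ℕ := ∑ i : Fin m, T.r i.castSucc * 2 * T.r i.succ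

/-- The rank: the largest of the numbers `r i`. -/
def rank (T : TensorTrain m) : ℕ := Finset.univ.sup T.r

end TensorTrain

/-- A tensor train representation, following the variable order `ord`, of an `n`-ary Boolean
function: a tensor train with entries in `{-1, 0, 1}` of a binary tensor with `m ≥ 1` modes, and a
map `π` from modes to variables that is strictly increasing for `ord` (hence injective, so that
`m ≤ n`). -/
structure TTRep {n : ℕ} (ord : VarOrder n) where
  m : ℕ
  m_pos : 1 ≤ m
  train : TensorTrain m
  ternary : ∀ i b j k, train.core i b j k = -1 ∨ train.core i b j k = 0 ∨ train.core i b j k = 1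
  binary : ∀ a : Fin m → Bool, train.entry a = 0 ∨ train.entry a = 1
  π : Fin m → Fin n
  follows : ∀ i j : Fin m, i < j → ord.lt (π i) (π j)

namespace TTRep

variable {n : ℕ} {ord : VarOrder n}

/-- The represented Boolean function: the mode `i` reads the variable `π i`. -/
def fn (T : TTRep ord) : BoolFun n := fun x => decide (T.train.entry (fun i => x (T.π i)) = 1)

/-- The size of the representation: the size of the tensor train. -/
def size (T : TTRep ord) : ℕ := T.train.size

end TTRep

/-! ### Succinctness -/

/-- A class of representations of Boolean functions: for each arity, a type of representations, the
function that each of them represents, and its size. -/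
structure RepClass where
  Rep : ℕ → Type*
  fn : ∀ {n : ℕ}, Rep n → BoolFun n
  size : ∀ {n : ℕ}, Rep n → ℕ

namespace RepClass

/-- `A` is at least as succinct as `B`: with one polynomial `p`, every representation `β ∈ B` of a
Boolean function with at least one variable has an equivalent `α ∈ A` with `|α| ≤ p(|β|)`. -/
def AtLeastAsSuccinct (A B : RepClass) : Prop :=
  ∃ p : Polynomial ℕ, ∀ n : ℕ, 1 ≤ n → ∀ β : B.Rep n,
    ∃ α : A.Rep n, A.fn α = B.fn β ∧ A.size α ≤ p.eval (B.size β)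

/-- `A` is more succinct than `B`. -/
def MoreSuccinct (A B : RepClass) : Prop :=
  A.AtLeastAsSuccinct B ∧ ¬ B.AtLeastAsSuccinct A

end RepClass

/-- The class `OBDD_<`, for a variable order for each number of variables. -/
noncomputable def obddClass (ord : ∀ n, VarOrder n) : RepClass where
  Rep n := OBDD (ord n)
  fn B := B.fn
  size B := B.size

/-- The class `TT_<`, for a variable order for each number of variables. -/
def ttClass (ord : ∀ n, VarOrder n) : RepClass where
  Rep n := TTRep (ord n)
  fn T := T.fn
  size T := T.size

/-! ### The hidden weighted bit function -/

/-- The number of ones `∑ x_i` of an assignment. -/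
def hammingWeight {n : ℕ} (x : Fin n → Bool) : ℕ := ∑ i, (x i).toNat

theorem hammingWeight_le {n : ℕ} (x : Fin n → Bool) : hammingWeight x ≤ n := by
  refine (Finset.sum_le_card_nsmul _ _ 1 fun i _ => Bool.toNat_le (x i)).trans ?_
  simp

/-- `HWB_n(x) = x_{∑ x_i}` if `x ≠ 0`, and `HWB_n(0) = 0`; the variable `x_k` is the coordinate
`k - 1`. -/
def hwb (n : ℕ) : BoolFun n := fun x =>
  if h : hammingWeight x = 0 then false
  else x ⟨hammingWeight x - 1, by have := hammingWeight_le x; omega⟩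

/-! A tensor train is a layered weighted automaton: the ranks count the states of the layers, the
cores hold the transition weights, and an entry is the total weight of all runs. In a level-wise
smooth OBDD every path visits each level once, so its nodes serve as states of a deterministic
automaton. A general OBDD is made smooth by letting a node wait through the levels that an edge
skips.

The separation uses nondeterminism. For HWB the order may read the selected variable before the
total weight is known; the automaton tracks the weight of the prefix and, on reading a one, guesses
the weight of the rest so that this one is the selected bit. At most one run per input survives, so
weights 0 and 1 suffice and the rank is linear in `n` (`exists_ttRep_hwb`).

An OBDD cannot guess. After an initial segment `D` of the order it needs a node for each
subfunction, and HWB has exponentially many: patterns on a window `W ⊆ D` of possible target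
positions are padded to equal weight, and the variables outside `D` can then steer the total weight
to any position of `W` (`OBDD.card_le_size_of_hwb`). Whatever the order, `D` meets one of two
candidate windows in enough positions (`OBDD.two_pow_le_of_hwb`). -/

/-! ### Enumerations of variables and basic facts on OBDDs -/

theorem exists_enumeration {α : Type*} (r : α → α → Prop) [IsStrictTotalOrder α r] (V : Finset α) :
    ∃ e : Fin V.card → α, Set.range e = V ∧ ∀ i j, r (e i) (e j) ↔ i < j := by
  classical
  let _ : LinearOrder α := linearOrderOfSTO r
  exact ⟨V.orderEmbOfFin rfl, V.range_orderEmbOfFin rfl, fun i j =>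
    (V.orderEmbOfFin rfl).lt_iff_lt⟩

theorem VarOrder.exists_enum {n : ℕ} (ord : VarOrder n) (V : Set (Fin n)) :
    ∃ e : Fin V.ncard → Fin n, Set.range e = V ∧ ∀ i j, ord.lt (e i) (e j) ↔ i < j := by
  have := ord.isOrder
  obtain ⟨V, rfl⟩ := V.toFinite.exists_finset_coe
  rw [Set.ncard_coe_finset]
  exact exists_enumeration ord.lt V

namespace OBDD

variable {n : ℕ} {ord : VarOrder n}

/-- The child of `v` along the edge for the value `b` of the label of `v`. -/
def child (B : OBDD ord) (b : Bool) (v : B.Node) : B.Node ⊕ Bool := if b then B.hi v else B.lo v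

theorem child_edge {B : OBDD ord} {b : Bool} {v : B.Node} {u : B.Node ⊕ Bool}
    (h : B.child b v = u) : B.lo v = u ∨ B.hi v = u := by
  cases b
  · exact Or.inl h
  · exact Or.inr h

theorem exists_child_of_edge {B : OBDD ord} {v : B.Node} {u : B.Node ⊕ Bool}
    (h : B.lo v = u ∨ B.hi v = u) : ∃ b, B.child b v = u := by
  rcases h with h | h
  · exact ⟨false, h⟩
  · exact ⟨true, h⟩

@[simp] theorem eval_inr (B : OBDD ord) (x : Fin n → Bool) (b : Bool) :
    B.eval x (Sum.inr b) = b := by rw [eval]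

theorem eval_inl (B : OBDD ord) (x : Fin n → Bool) (v : B.Node) :
    B.eval x (Sum.inl v) = B.eval x (B.child (x (B.var v)) v) := by
  rw [eval, child]
  cases x (B.var v) <;> simp

theorem height_child_lt (B : OBDD ord) (b : Bool) (v : B.Node) :
    B.height (B.child b v) < B.height (Sum.inl v) :=
  B.height_lt v _ (child_edge rfl)

/-- Induction along the edges of an OBDD, from the terminals upwards. -/
theorem node_induction (B : OBDD ord) {P : B.Node ⊕ Bool → Prop} (inr : ∀ b, P (Sum.inr b))
    (inl : ∀ v, (∀ b, P (B.child b v)) → P (Sum.inl v)) (u : B.Node ⊕ Bool) : P u := by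
  induction h : B.height u using Nat.strong_induction_on generalizing u with
  | _ k ih =>
    subst h
    rcases u with v | b
    · exact inl v fun b => ih _ (B.height_child_lt b v) _ rfl
    · exact inr b

/-- The restriction of a diagram to its reachable nodes is an OBDD. -/
theorem exists_reachable {N : Type} [Fintype N] (root : N) (var : N → Fin n)
    (child : Bool → N → N ⊕ Bool)
    (ordered : ∀ b v c, child b v = Sum.inl c → ord.lt (var v) (var c)) :
    ∃ (L : OBDD ord) (φ : L.Node → N), Function.Injective φ ∧
      (∀ q, Relation.ReflTransGen (fun v c => ∃ b, child b v = Sum.inl c) root (φ q)) ∧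
      (∃ q, L.root = Sum.inl q ∧ φ q = root) ∧ (∀ q, L.var q = var (φ q)) ∧
      ∀ b q, Sum.map φ id (L.child b q) = child b (φ q) := by
  classical
  let E : N → N → Prop := fun v c => ∃ b, child b v = Sum.inl c
  let R : N → Prop := Relation.ReflTransGen E root
  let lift : (u : N ⊕ Bool) → (∀ c, u = Sum.inl c → R c) → {v // R v} ⊕ Bool := fun u =>
    match u with
    | Sum.inl c => fun h => Sum.inl ⟨c, h c rfl⟩
    | Sum.inr b => fun _ => Sum.inr b
  have lift_map : ∀ u h, Sum.map Subtype.val id (lift u h) = u := by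
    rintro (c | b) h <;> rfl
  have hR : ∀ b (q : {v // R v}) c, child b q.1 = Sum.inl c → R c := fun b q c hc =>
    q.2.tail ⟨b, hc⟩
  have lift_inl : ∀ u h (c : {v // R v}), lift u h = Sum.inl c ↔ u = Sum.inl c.1 := by
    rintro (c | b) h d
    · simp [lift, Subtype.ext_iff]
    · simp [lift]
  let L : OBDD ord :=
    { Node := {v // R v}
      root := Sum.inl ⟨root, .refl⟩
      var := fun v => var v.1
      lo := fun v => lift (child false v.1) (hR _ v)
      hi := fun v => lift (child true v.1) (hR _ v)
      ordered := by
        intro v c h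
        rw [lift_inl, lift_inl] at h
        exact h.elim (ordered _ _ _) (ordered _ _ _)
      rooted := by
        rintro ⟨u, hu⟩
        refine ⟨_, rfl, ?_⟩
        induction hu with
        | refl => exact .refl
        | tail hb hc ih =>
          refine ih.tail ?_
          rw [lift_inl, lift_inl]
          obtain ⟨_ | _, hc⟩ := hc
          · exact Or.inl hc
          · exact Or.inr hc }
  refine ⟨L, Subtype.val, Subtype.val_injective, fun q => q.2, ⟨_, rfl, rfl⟩, fun _ => rfl, ?_⟩
  rintro (_ | _) q <;> exact lift_map _ _

end OBDD

/-! ### Level-wise smoothing -/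

namespace OBDD

variable {n : ℕ} {ord : VarOrder n}

/-- The levels of an OBDD: its labels, listed in increasing order. -/
theorem exists_levels (B : OBDD ord) :
    ∃ (e : Fin B.labels.ncard → Fin n) (lv : B.Node → Fin B.labels.ncard),
      (∀ i j, ord.lt (e i) (e j) ↔ i < j) ∧ Set.range e = B.labels ∧ (∀ v, e (lv v) = B.var v) ∧
      Function.Surjective lv ∧ ∀ b v c, B.child b v = Sum.inl c → lv v < lv c := by
  obtain ⟨e, he, hlt⟩ := ord.exists_enum B.labels
  have hmem : ∀ v, ∃ i, e i = B.var v := fun v => by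
    have : B.var v ∈ Set.range e := by
      rw [he]
      exact Set.mem_range_self v
    exact this
  choose lv hlv using hmem
  have := ord.isOrder
  have hinj : Function.Injective e := by
    intro i j hij
    rcases lt_trichotomy i j with h | h | h
    · exact absurd ((hlt i j).2 h) (hij ▸ irrefl _)
    · exact h
    · exact absurd ((hlt j i).2 h) (hij ▸ irrefl _)
  refine ⟨e, lv, hlt, he, hlv, fun i => ?_, fun b v c h => ?_⟩
  · have : e i ∈ B.labels := he ▸ Set.mem_range_self i
    obtain ⟨v, hv⟩ := this
    exact ⟨v, hinj ((hlv v).trans hv)⟩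
  · rw [← hlt, hlv, hlv]
    exact B.ordered v c (child_edge h)

theorem isEmpty_of_root_eq_inr {B : OBDD ord} {b : Bool} (h : B.root = Sum.inr b) :
    IsEmpty B.Node :=
  ⟨fun u => by obtain ⟨r, hr, -⟩ := B.rooted u; simp [h] at hr⟩

/-- Every node other than the root has a label after that of the root. -/
theorem eq_root_or_lt {B : OBDD ord} {r : B.Node} (h : B.root = Sum.inl r) (u : B.Node) :
    u = r ∨ ord.lt (B.var r) (B.var u) := by
  have := ord.isOrder
  obtain ⟨r', hr', hu⟩ := B.rooted u
  obtain rfl : r = r' := Sum.inl_injective (h.symm.trans hr')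
  induction hu with
  | refl => exact Or.inl rfl
  | tail _ hc ih =>
    have := B.ordered _ _ hc
    rcases ih with rfl | ih
    · exact Or.inr this
    · exact Or.inr (_root_.trans ih this)

theorem labels_ncard_le (B : OBDD ord) : B.labels.ncard + 2 ≤ B.size := by
  let _ := B.fintypeNode
  simp only [size, labels, ← Set.image_univ]
  have := Set.ncard_image_le (f := B.var) (Set.finite_univ)
  rw [Set.ncard_univ, Nat.card_eq_fintype_card] at this
  omega

/-- A node of `L` is a pair of a node `u` of `B` and a level `i`, meaning that `u` is the current
position when the `i`-th label is about to be read. Reading moves `u` along its edge if `u` carries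
that label and otherwise leaves it waiting, so each edge descends exactly one level. -/
theorem exists_levelwiseSmooth (B : OBDD ord) :
    ∃ L : OBDD ord, L.IsLevelwiseSmooth B.labels ∧ L.fn = B.fn ∧
      L.size ≤ B.size * max 1 B.labels.ncard := by
  classical
  let _ := B.fintypeNode
  rcases hroot : B.root with r | b
  swap
  · have := isEmpty_of_root_eq_inr hroot
    exact ⟨B, fun v => isEmptyElim v, rfl, Nat.le_mul_of_pos_right _ (by simp)⟩
  obtain ⟨e, lv, hlt, he, hlv, -, hchild⟩ := B.exists_levels
  have hk : 0 < B.labels.ncard := (Nat.zero_le _).trans_lt (lv r).2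
  generalize B.labels.ncard = k at e lv hlt he hlv hchild hk
  have := ord.isOrder
  let next : Bool → (B.Node ⊕ Bool) → Fin k → B.Node ⊕ Bool := fun b u i =>
    match u with
    | Sum.inl v => if lv v = i then B.child b v else Sum.inl v
    | Sum.inr c => Sum.inr c
  have next_above : ∀ b u i, (∀ v, u = Sum.inl v → i ≤ lv v) →
      ∀ w, next b u i = Sum.inl w → i < lv w := by
    rintro b (v | c) i h w hw
    · simp only [next] at hw
      split_ifs at hw with hvi
      · exact hvi ▸ hchild b v w hw
      · obtain rfl := Sum.inl_injective hw
        exact lt_of_le_of_ne (h _ rfl) (Ne.symm hvi)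
    · simp [next] at hw
  have eval_next : ∀ x u i, B.eval x (next (x (e i)) u i) = B.eval x u := by
    rintro x (v | c) i
    · simp only [next]
      split_ifs with hvi
      · rw [eval_inl, ← hlv, hvi]
      · rfl
    · rfl
  -- After the last level the position is a terminal, so the default `false` for a non-terminal
  -- never matters on reachable pairs.
  let child' : Bool → (B.Node ⊕ Bool) × Fin k → ((B.Node ⊕ Bool) × Fin k) ⊕ Bool := fun b p =>
    if h : p.2.val + 1 < k then Sum.inl (next b p.1 p.2, ⟨p.2 + 1, h⟩)
    else Sum.inr (Sum.elim (fun _ => false) id (next b p.1 p.2))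
  have child'_inl : ∀ b p q, child' b p = Sum.inl q →
      q.1 = next b p.1 p.2 ∧ q.2.val = p.2.val + 1 := by
    intro b p q h
    simp only [child'] at h
    split_ifs at h
    obtain rfl := Sum.inl_injective h
    exact ⟨rfl, rfl⟩
  have child'_inr : ∀ b p c, child' b p = Sum.inr c →
      k = p.2.val + 1 ∧ c = Sum.elim (fun _ => false) id (next b p.1 p.2) := by
    intro b p c h
    simp only [child'] at h
    split_ifs at h with hk
    exact ⟨by omega, (Sum.inr_injective h).symm⟩
  obtain ⟨L, φ, hφ, hreach, ⟨q₀, hq₀, hφq₀⟩, hvar, hLchild⟩ :=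
    exists_reachable (ord := ord) (B.root, (⟨0, hk⟩ : Fin k)) (fun p => e p.2) child' (by
      intro b v c h
      obtain ⟨-, h⟩ := child'_inl b v c h
      simp only [hlt, Fin.lt_def]
      omega)
  -- The label of the current position has not been passed yet, and level 0 contains only the root;
  -- the latter is what saves two nodes in the count.
  have inv : ∀ q, (∀ v, (φ q).1 = Sum.inl v → (φ q).2 ≤ lv v) ∧
      ((φ q).2.val = 0 → (φ q).1 = B.root) := by
    intro q
    have hq := hreach q
    generalize φ q = p at hq
    induction hq with
    | refl => exact ⟨fun v _ => Nat.zero_le _, fun _ => rfl⟩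
    | tail _ hc ih =>
      obtain ⟨b, hc⟩ := hc
      obtain ⟨h1, h2⟩ := child'_inl _ _ _ hc
      refine ⟨fun v hv => ?_, fun h => by omega⟩
      have := next_above _ _ _ ih.1 v (h1 ▸ hv)
      simp only [Fin.le_def, Fin.lt_def] at *
      omega
  have hinl : ∀ b q q', L.child b q = Sum.inl q' → child' b (φ q) = Sum.inl (φ q') := by
    intro b q q' h
    rw [← hLchild, h, Sum.map_inl]
  have hinr : ∀ b q c, L.child b q = Sum.inr c → child' b (φ q) = Sum.inr c := by
    intro b q q' h
    rw [← hLchild, h, Sum.map_inr, id]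
  have heval : ∀ x u q, u = Sum.inl q → L.eval x u = B.eval x (φ q).1 := by
    intro x u
    refine L.node_induction (P := fun u => ∀ q, u = Sum.inl q → L.eval x u = B.eval x (φ q).1)
      ?_ ?_ u
    · simp
    · rintro q ih _ ⟨⟩
      rw [eval_inl, hvar, ← eval_next x (φ q).1 (φ q).2]
      rcases h : L.child (x (e (φ q).2)) q with q' | c
      · rw [← h, ih _ _ h, (child'_inl _ _ _ (hinl _ _ _ h)).1]
      · obtain ⟨h1, h2⟩ := child'_inr _ _ _ (hinr _ _ _ h)
        rcases h3 : next (x (e (φ q).2)) (φ q).1 (φ q).2 with w | c'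
        · have := next_above _ _ _ (inv q).1 w h3
          simp only [Fin.lt_def] at this
          omega
        · rw [h3] at h2
          simp [h2]
  refine ⟨L, fun q => ⟨?_, ?_, ?_⟩, ?_, ?_⟩
  · rw [hvar, ← he]
    exact Set.mem_range_self _
  · rintro q' h ⟨y, hy, h1, h2⟩
    obtain ⟨b, h⟩ := exists_child_of_edge h
    rw [← he] at hy
    obtain ⟨j, rfl⟩ := hy
    rw [hvar, hlt, Fin.lt_def] at h1 h2
    have := (child'_inl _ _ _ (hinl _ _ _ h)).2
    omega
  · rintro c h ⟨y, hy, h1⟩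
    obtain ⟨b, h⟩ := exists_child_of_edge h
    rw [← he] at hy
    obtain ⟨j, rfl⟩ := hy
    rw [hvar, hlt, Fin.lt_def] at h1
    have := (child'_inr _ _ _ (hinr _ _ _ h)).1
    omega
  · funext x
    rw [fn, fn, heval x _ _ hq₀, hφq₀]
  · let _ := L.fintypeNode
    -- The root is non-terminal, so these two pairs are unreachable; they make room for the two
    -- terminals of `L` within `|B| * k`.
    let D : Finset ((B.Node ⊕ Bool) × Fin k) :=
      {(Sum.inr false, ⟨0, hk⟩), (Sum.inr true, ⟨0, hk⟩)}
    have hD : D.card = 2 := Finset.card_pair (by simp)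
    have hle : Fintype.card L.Node ≤ Dᶜ.card := by
      refine Finset.card_le_card_of_injOn φ (fun q _ => ?_) hφ.injOn
      simp only [D, Finset.coe_compl, Set.mem_compl_iff, Finset.mem_coe, Finset.mem_insert,
        Finset.mem_singleton]
      have := (inv q).2
      rw [hroot] at this
      rintro (h | h) <;> simp [h] at this
    rw [Finset.card_compl, hD, Fintype.card_prod, Fintype.card_sum, Fintype.card_bool,
      Fintype.card_fin] at hle
    have h2 : 2 ≤ (Fintype.card B.Node + 2) * k := by nlinarith
    rw [max_eq_right hk, size, size]
    omega

end OBDD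

/-! ### Tensor trains as layered weighted automata -/

namespace TensorTrain

theorem partialProduct_zero {m : ℕ} (T : TensorTrain m) (a : Fin m → Bool) :
    T.partialProduct a 0 = 1 := rfl

theorem partialProduct_succ {m : ℕ} (T : TensorTrain m) (a : Fin m → Bool) (i : Fin m) :
    T.partialProduct a i.succ = T.partialProduct a i.castSucc * T.core i (a i) := rfl

end TensorTrain

/-- A weighted automaton with layers `S 0, …, S m` of states and transition weights `M` is computed
by a tensor train. -/
theorem exists_tensorTrain {σ : Type*} {m : ℕ} (S : ℕ → Finset σ) (M : ℕ → Bool → σ → σ → ℤ)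
    {s₀ s₁ : σ} (h₀ : S 0 = {s₀}) (h₁ : S m = {s₁}) (hS : ∀ i ≤ m, (S i).Nonempty) :
    ∃ T : TensorTrain m, (∀ i, T.r i = (S i).card) ∧
      (∀ i b j k, ∃ s t, T.core i b j k = M i b s t) ∧
      ∀ (a : Fin m → Bool) (F : ℕ → σ → ℤ), F 0 s₀ = 1 →
        (∀ i : Fin m, ∀ t ∈ S (i + 1), F (i + 1) t = ∑ s ∈ S i, F i s * M i (a i) s t) →
        T.entry a = F m s₁ := by
  let T : TensorTrain m :=
    { r := fun i => (S i).card
      r_pos := fun i => Finset.card_pos.2 (hS i (Nat.lt_succ_iff.1 i.2))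
      r_first := by simp [h₀]
      r_last := by simp [h₁]
      core := fun i b => Matrix.of fun j k =>
        M i b ((S i.castSucc).equivFin.symm j) ((S i.succ).equivFin.symm k) }
  refine ⟨T, fun _ => rfl, fun i b j k => ⟨_, _, rfl⟩, fun a F hF0 hF => ?_⟩
  -- The partial product is the row vector of forward weights, and the recurrence assumed for `F` is
  -- its multiplication by the next core.
  have key : ∀ (i : Fin (m + 1)) (k : Fin (T.r i)),
      T.partialProduct a i ⟨0, T.r_pos 0⟩ k = F i ((S i).equivFin.symm k) := by
    intro i
    induction i using Fin.induction with
    | zero =>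
      intro k
      have hk : ((S (0 : Fin (m + 1))).equivFin.symm k : σ) = s₀ := by
        have := ((S (0 : Fin (m + 1))).equivFin.symm k).2
        simpa [h₀] using this
      have hk0 : k = ⟨0, T.r_pos 0⟩ := by
        have h1 := T.r_first
        have h2 := k.2
        ext
        simp only
        omega
      rw [hk, T.partialProduct_zero, hk0, Matrix.one_apply_eq]
      exact hF0.symm
    | succ i ih =>
      intro k
      rw [T.partialProduct_succ, Matrix.mul_apply]
      simp only [ih]
      refine Eq.trans ?_ (hF i _ (Finset.coe_mem ((S i.succ).equivFin.symm k))).symm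
      rw [← Finset.sum_coe_sort (S i)]
      exact Equiv.sum_comp (S i).equivFin.symm
        (fun s => F i s * M i (a i) s ((S i.succ).equivFin.symm k))
  rw [TensorTrain.entry, key]
  have := ((S (Fin.last m)).equivFin.symm ⟨0, T.r_pos (Fin.last m)⟩).2
  simp only [Fin.val_last, h₁, Finset.mem_singleton] at this
  exact congrArg (F m) this

/-- A layered weighted automaton whose value on the bits `x (π i)` is a Boolean function of `x`
gives a tensor train representation of this function. -/
theorem exists_ttRep {n : ℕ} {ord : VarOrder n} {σ : Type*} {m : ℕ} (hm : 1 ≤ m)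
    (S : ℕ → Finset σ) (M : ℕ → Bool → σ → σ → ℤ)
    {s₀ s₁ : σ} (h₀ : S 0 = {s₀}) (h₁ : S m = {s₁}) (hS : ∀ i ≤ m, (S i).Nonempty)
    (hM : ∀ i b s t, M i b s t = -1 ∨ M i b s t = 0 ∨ M i b s t = 1)
    (π : Fin m → Fin n) (hπ : ∀ i j, i < j → ord.lt (π i) (π j))
    (f : BoolFun n) (F : (Fin n → Bool) → ℕ → σ → ℤ) (hF0 : ∀ x, F x 0 s₀ = 1)
    (hF : ∀ (x) (i : Fin m), ∀ t ∈ S (i + 1),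
      F x (i + 1) t = ∑ s ∈ S i, F x i s * M i (x (π i)) s t)
    (hFf : ∀ x, F x m s₁ = if f x then 1 else 0) :
    ∃ T : TTRep ord, T.fn = f ∧ T.train.rank = (Finset.range (m + 1)).sup (fun i => (S i).card) ∧
      T.size = ∑ i ∈ Finset.range m, (S i).card * 2 * (S (i + 1)).card := by
  obtain ⟨T, hr, hcore, hentry⟩ := exists_tensorTrain S M h₀ h₁ hS
  have := ord.isOrder
  have hinj : Function.Injective π := by
    intro i j hij
    rcases lt_trichotomy i j with h | h | h
    · exact absurd (hπ i j h) (hij ▸ irrefl _)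
    · exact h
    · exact absurd (hπ j i h) (hij ▸ irrefl _)
  have hT : ∀ x : Fin n → Bool, T.entry (fun i => x (π i)) = if f x then 1 else 0 := fun x => by
    rw [hentry _ (F x) (hF0 x) (hF x), hFf]
  refine ⟨⟨m, hm, T, fun i b j k => ?_, fun a => ?_, π, hπ⟩, ?_, ?_, ?_⟩
  · obtain ⟨s, t, h⟩ := hcore i b j k
    rw [h]
    exact hM i b s t
  -- By injectivity of `π` every tuple of mode values comes from an assignment, so all entries of
  -- the tensor are values of `f`.
  · have : a = fun i => Function.extend π a (fun _ => false) (π i) := by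
      funext i
      rw [hinj.extend_apply]
    rw [this, hT]
    split_ifs <;> simp
  · funext x
    simp only [TTRep.fn, hT]
    cases f x <;> simp
  · change Finset.univ.sup T.r = _
    apply le_antisymm
    · exact Finset.sup_le fun i _ => (hr i).le.trans
        (Finset.le_sup (f := fun i => (S i).card) (Finset.mem_range.2 i.2))
    · refine Finset.sup_le fun i hi => (hr ⟨i, Finset.mem_range.1 hi⟩).ge.trans ?_
      exact Finset.le_sup (Finset.mem_univ _)
  · simp only [TTRep.size, TensorTrain.size, hr]
    exact Fin.sum_univ_eq_sum_range (fun i => (S i).card * 2 * (S (i + 1)).card) m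

/-- The summands are among the cross terms of the expanded square. -/
theorem sum_mul_succ_le_sq (c : ℕ → ℕ) (m : ℕ) :
    ∑ i ∈ Finset.range m, c i * 2 * c (i + 1) ≤ (∑ i ∈ Finset.range (m + 1), c i) ^ 2 := by
  induction m with
  | zero => simp
  | succ m ih =>
    rw [Finset.sum_range_succ, Finset.sum_range_succ _ (m + 1)]
    have : c m ≤ ∑ i ∈ Finset.range (m + 1), c i :=
      Finset.single_le_sum (fun _ _ => Nat.zero_le _) (Finset.self_mem_range_succ m)
    nlinarith [Nat.mul_le_mul_right (c (m + 1)) this]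

/-! ### From smooth OBDDs to tensor trains -/

namespace OBDD

variable {n : ℕ} {ord : VarOrder n}

/-- Smoothness puts the path of `x` on level `i` after `i` steps, so the forward weights are the
indicator of its current node. The layers are disjoint sets of nodes, hence their cardinalities sum
to at most `|L|`, and `sum_mul_succ_le_sq` gives the square. -/
theorem exists_ttRep_of_isLevelwiseSmooth {V : Set (Fin n)} (L : OBDD ord) (hn : 1 ≤ n)
    (hL : L.IsLevelwiseSmooth V) : ∃ T : TTRep ord, T.fn = L.fn ∧ T.size ≤ L.size ^ 2 := by
  classical
  let _ := L.fintypeNode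
  rcases hroot : L.root with r | b
  swap
  -- A constant function still needs a mode: one `1 × 2 × 1` core with both entries equal to the
  -- constant, of size 2.
  · obtain ⟨T, h1, -, h2⟩ := exists_ttRep (ord := ord) (σ := Unit) le_rfl (fun _ => {()})
      (fun _ _ _ _ => if b then 1 else 0) rfl (m := 1) rfl (fun _ _ => by simp)
      (fun _ _ _ _ => by cases b <;> simp) (fun _ => ⟨0, hn⟩) (fun i j h => by omega) L.fn
      (fun _ i _ => if i = 0 then 1 else if b then 1 else 0) (by simp)
      (by simp) (fun x => by simp [fn, hroot])
    refine ⟨T, h1, ?_⟩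
    rw [h2, size]
    simp only [Finset.sum_range_one, Finset.card_singleton]
    nlinarith [Nat.zero_le (Fintype.card L.Node)]
  obtain ⟨e, lv, hlt, -, hlv, hsurj, hchild⟩ := L.exists_levels
  have hVlv : ∀ i, e i ∈ V := fun i => by
    obtain ⟨v, rfl⟩ := hsurj i
    rw [hlv]
    exact (hL v).1
  have hroot0 : ∀ v, lv r ≤ lv v ∧ (lv v = lv r → v = r) := fun v => by
    rcases eq_root_or_lt hroot v with rfl | h
    · simp
    · rw [← hlv, ← hlv, hlt] at h
      exact ⟨h.le, fun h' => absurd h'.symm h.ne⟩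
  have hk : 1 ≤ L.labels.ncard := (Nat.zero_le _).trans_lt (lv r).2
  generalize L.labels.ncard = k at e lv hlt hlv hsurj hchild hk hVlv hroot0
  have hr0 : (lv r).val = 0 := by
    obtain ⟨v, hv⟩ := hsurj ⟨0, hk⟩
    have := (hroot0 v).1
    rw [hv, Fin.le_def] at this
    exact Nat.le_zero.1 this
  have hstep : ∀ b v c, L.child b v = Sum.inl c → (lv c).val = lv v + 1 := by
    intro b v c h
    have h1 := hchild b v c h
    have h2 := (hL v).2.1 c (child_edge h)
    by_contra hne
    rw [Fin.lt_def] at h1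
    have hlt' : (lv v).val + 1 < k := by have := (lv c).2; omega
    refine h2 ⟨e ⟨lv v + 1, hlt'⟩, hVlv _, ?_, ?_⟩
    · rw [← hlv, hlt, Fin.lt_def]
      simp
    · rw [← hlv, hlt, Fin.lt_def]
      simp only
      omega
  have hlast : ∀ b v c, L.child b v = Sum.inr c → (lv v).val + 1 = k := by
    intro b v c h
    have h2 := (hL v).2.2 c (child_edge h)
    by_contra hne
    have hlt' : (lv v).val + 1 < k := by have := (lv v).2; omega
    refine h2 ⟨e ⟨lv v + 1, hlt'⟩, hVlv _, ?_⟩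
    rw [← hlv, hlt, Fin.lt_def]
    simp
  -- `⊤` is on level `k`, and `⊥` is left out
  let lev : L.Node ⊕ Bool → ℕ := Sum.elim (fun v => lv v) (fun c => if c then k else k + 1)
  let S : ℕ → Finset (L.Node ⊕ Bool) := fun i => Finset.univ.filter fun u => lev u = i
  have hS : ∀ i u, u ∈ S i ↔ lev u = i := fun i u => by simp [S]
  have lev_inl : ∀ v, lev (Sum.inl v) = lv v := fun v => rfl
  let step : (Fin n → Bool) → L.Node ⊕ Bool → L.Node ⊕ Bool := fun x =>
    Sum.elim (fun v => L.child (x (L.var v)) v) Sum.inr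
  let state : (Fin n → Bool) → ℕ → L.Node ⊕ Bool := fun x i => (step x)^[i] L.root
  have state_succ : ∀ x i, state x (i + 1) = step x (state x i) := fun x i =>
    Function.iterate_succ_apply' _ _ _
  have eval_state : ∀ x i, L.eval x (state x i) = L.fn x := by
    intro x i
    induction i with
    | zero => rfl
    | succ i ih =>
      rw [state_succ, ← ih]
      rcases state x i with v | c
      · rw [eval_inl]; rfl
      · rfl
  have state_lt : ∀ x i, i < k → ∃ v, state x i = Sum.inl v ∧ (lv v).val = i := by
    intro x i
    induction i with
    | zero => exact fun _ => ⟨r, hroot, hr0⟩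
    | succ i ih =>
      intro hi
      obtain ⟨v, hv, hvi⟩ := ih (by omega)
      rw [state_succ, hv]
      simp only [step, Sum.elim_inl]
      rcases h : L.child (x (L.var v)) v with w | c
      · exact ⟨w, rfl, by rw [hstep _ _ _ h, hvi]⟩
      · have := hlast _ _ _ h
        omega
  have state_k : ∀ x, state x k = Sum.inr (L.fn x) := by
    intro x
    obtain ⟨v, hv, hvi⟩ := state_lt x (k - 1) (by omega)
    rw [← eval_state x k]
    have : state x k = step x (state x (k - 1)) := by
      rw [← state_succ]
      congr
      omega
    rw [this, hv]
    simp only [step, Sum.elim_inl]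
    rcases h : L.child (x (L.var v)) v with w | c
    · have := hstep _ _ _ h
      have := (lv w).2
      omega
    · simp
  have hT := exists_ttRep (ord := ord) hk S
    (fun _ b u t => Sum.elim (fun v => if L.child b v = t then 1 else 0) (fun _ => 0) u)
    (s₀ := L.root) (s₁ := Sum.inr true) ?_ ?_ ?_ ?_ e (fun i j h => (hlt i j).2 h) L.fn
    (fun x i u => if state x i = u then 1 else 0) ?_ ?_ ?_
  · obtain ⟨T, h1, -, h2⟩ := hT
    refine ⟨T, h1, ?_⟩
    rw [h2]
    refine (sum_mul_succ_le_sq _ k).trans (Nat.pow_le_pow_left ?_ 2)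
    rw [← Finset.card_biUnion]
    · refine (Finset.card_le_univ _).trans ?_
      simp [size]
    · intro i _ j _ hij
      rw [Function.onFun, Finset.disjoint_left]
      intro u hu hu'
      rw [hS] at hu hu'
      exact hij (hu.symm.trans hu')
  · ext u
    rw [hS, Finset.mem_singleton, hroot]
    rcases u with v | c
    · simp only [lev_inl, Sum.inl.injEq]
      refine ⟨fun h => (hroot0 v).2 (Fin.ext (by rw [h, hr0])), ?_⟩
      rintro rfl
      exact hr0
    · cases c
      · simp [lev]
      · simp [lev]
        omega
  · ext u
    rw [hS, Finset.mem_singleton]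
    rcases u with v | c
    · simp [lev_inl, (lv v).2.ne]
    · cases c <;> simp [lev]
  · intro i hi
    rcases hi.lt_or_eq with hi | rfl
    · obtain ⟨v, hv⟩ := hsurj ⟨i, hi⟩
      exact ⟨Sum.inl v, by rw [hS, lev_inl, hv]⟩
    · exact ⟨Sum.inr true, by simp [hS, lev]⟩
  · rintro - b (v | c) t
    · simp only [Sum.elim_inl]
      split_ifs <;> simp
    · simp
  · intro x
    simp [state]
  · intro x i t ht
    obtain ⟨v, hv, hvi⟩ := state_lt x i i.2
    have hst : step x (Sum.inl v) = L.child (x (e i)) v := by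
      rw [← Fin.ext hvi, hlv]
      rfl
    rw [state_succ, hv, hst, Finset.sum_eq_single (Sum.inl v)]
    · simp only [Sum.elim_inl, if_true, one_mul]
    · intro u _ hu
      rw [if_neg (Ne.symm hu), zero_mul]
    · intro h
      exact absurd ((hS _ _).2 (by rw [lev_inl, hvi])) h
  · intro x
    rw [state_k]
    simp

end OBDD

/-! ### A tensor train of linear rank for HWB -/

theorem VarOrder.exists_enum_univ {n : ℕ} (ord : VarOrder n) :
    ∃ e : Fin n → Fin n, Function.Bijective e ∧ ∀ i j, ord.lt (e i) (e j) ↔ i < j := by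
  obtain ⟨e, he, hlt⟩ := ord.exists_enum Set.univ
  have hcard : (Set.univ : Set (Fin n)).ncard = n := by simp [Set.ncard_univ]
  generalize (Set.univ : Set (Fin n)).ncard = k at e he hlt hcard
  subst hcard
  exact ⟨e, Finite.surjective_iff_bijective.1 (Set.range_eq_univ.1 he), hlt⟩

theorem ite_or_of_not_and {P Q : Prop} [Decidable P] [Decidable Q] [Decidable (P ∨ Q)]
    (h : ¬ (P ∧ Q)) :
    (if P ∨ Q then 1 else 0 : ℤ) = (if P then 1 else 0) + if Q then 1 else 0 := by
  by_cases hP : P <;> by_cases hQ : Q <;> simp_all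

theorem exists_hwb_eq_iff {n : ℕ} (x : Fin n → Bool) :
    hwb n x = true ↔ ∃ l : Fin n, l.val + 1 = hammingWeight x ∧ x l = true := by
  simp only [hwb]
  split_ifs with h
  · simp [h]
  · constructor
    · exact fun hx => ⟨_, by simp only; omega, hx⟩
    · rintro ⟨l, hl, hx⟩
      convert hx using 2
      ext
      simp only
      omega

/-- An inner layer has `(n - i + 1) + (i + 1) = n + 2` states, at most `2 * n` because inner layers
exist only for `n ≥ 2`. The size bound is `n` cores with at most `2 * (2 * n) ^ 2` entries each. -/
theorem exists_ttRep_hwb {n : ℕ} (ord : VarOrder n) (hn : 1 ≤ n) :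
    ∃ T : TTRep ord, T.fn = hwb n ∧ T.train.rank ≤ 2 * n ∧ T.size ≤ 8 * n ^ 3 := by
  classical
  obtain ⟨e, he, hlt⟩ := ord.exists_enum_univ
  let p : ℕ → ℕ := fun i => if h : i < n then (e ⟨i, h⟩).val + 1 else 0
  let y : (Fin n → Bool) → ℕ → ℕ := fun x i => if h : i < n then (x (e ⟨i, h⟩)).toNat else 0
  let w : (Fin n → Bool) → ℕ → ℕ := fun x i => ∑ l ∈ Finset.range i, y x l
  have hp : ∀ i : Fin n, p i = (e i).val + 1 := fun i => by simp [p]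
  have hy : ∀ x (i : Fin n), y x i = (x (e i)).toNat := fun x i => by simp [y]
  have w_succ : ∀ x (i : Fin n), w x (i + 1) = w x i + (x (e i)).toNat := fun x i => by
    simp only [w]
    rw [Finset.sum_range_succ, hy]
  have w_le : ∀ x i, w x i ≤ i := by
    intro x i
    refine (Finset.sum_le_card_nsmul _ _ 1 fun l _ => ?_).trans (by simp)
    simp only [y]
    split_ifs
    · exact Bool.toNat_le _
    · exact Nat.zero_le _
  have w_n : ∀ x, w x n = hammingWeight x := by
    intro x
    rw [hammingWeight, ← he.sum_comp fun i => (x i).toNat]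
    simp only [w]
    rw [← Fin.sum_univ_eq_sum_range]
    exact Finset.sum_congr rfl fun i _ => hy x i
  -- `Sum.inr v`: the prefix has weight `v`; `Sum.inl j`: the prefix contains the selected variable,
  -- with value `1`, if the remaining weight is `j`
  let F : (Fin n → Bool) → ℕ → ℕ ⊕ ℕ → ℤ := fun x i => Sum.elim
    (fun j => if ∃ l : Fin n, l.val < i ∧ (e l).val + 1 = w x i + j ∧ x (e l) = true then 1 else 0)
    (fun v => if w x i = v then 1 else 0)
  let M : ℕ → Bool → ℕ ⊕ ℕ → ℕ ⊕ ℕ → ℤ := fun i b => Sum.elim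
    (fun j => Sum.elim (fun j' => if j = j' + b.toNat then 1 else 0) (fun _ => 0))
    (fun v => Sum.elim (fun j' => if b = true ∧ p i = v + 1 + j' then 1 else 0)
      (fun v' => if v' = v + b.toNat then 1 else 0))
  let R : ℕ → Finset (ℕ ⊕ ℕ) := fun i =>
    (Finset.range (n - i + 1)).disjSum (Finset.range (i + 1))
  -- The outer ranks must be 1: before any bit the prefix weight is 0, and at the end the remaining
  -- weight is 0.
  let S : ℕ → Finset (ℕ ⊕ ℕ) := fun i =>
    if i = 0 then {Sum.inr 0} else if i = n then {Sum.inl 0} else R i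
  have hSR : ∀ i, S i ⊆ R i := by
    intro i
    simp only [S]
    split_ifs with h1 h2
    · simp [R, h1]
    · simp [R, h2]
    · exact subset_rfl
  have hcard : ∀ i, i ≤ n → (S i).card ≤ 2 * n := by
    intro i hi
    simp only [S]
    split_ifs with h1 h2
    · simp only [Finset.card_singleton]; omega
    · simp only [Finset.card_singleton]; omega
    · simp only [R, Finset.card_disjSum, Finset.card_range]
      omega
  -- Cutting layer 0 down to one state loses nothing, since `F` vanishes on the others; layer `n` is
  -- never a source.
  have hFS : ∀ x (i : Fin n) (g : ℕ ⊕ ℕ → ℤ),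
      ∑ s ∈ S i, F x i s * g s = ∑ s ∈ R i, F x i s * g s := by
    intro x i g
    refine Finset.sum_subset (hSR i) fun s _ hs => ?_
    by_cases hi : i.val = 0
    · rcases s with j | v
      · simp [F, hi]
      · have : w x i ≠ v := by
          have := w_le x i
          rintro rfl
          refine hs ?_
          simp only [S, hi, if_true, Finset.mem_singleton]
          rw [hi] at this
          exact congrArg _ (Nat.le_zero.1 this)
        simp [F, this]
    · refine absurd ?_ hs
      simp only [S]
      rw [if_neg hi, if_neg i.2.ne]
      assumption
  have hT := exists_ttRep (ord := ord) hn S M (s₀ := Sum.inr 0) (s₁ := Sum.inl 0)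
    (by simp [S]) (by simp only [S, if_true]; rw [if_neg (by omega)]) ?_ ?_
    e (fun i j h => (hlt i j).2 h) (hwb n) F ?_ ?_ ?_
  · obtain ⟨T, h1, h2, h3⟩ := hT
    refine ⟨T, h1, ?_, ?_⟩
    · rw [h2]
      exact Finset.sup_le fun i hi => hcard i (Nat.lt_succ_iff.1 (Finset.mem_range.1 hi))
    · rw [h3]
      refine (Finset.sum_le_card_nsmul _ _ ((2 * n) * 2 * (2 * n)) fun i hi => ?_).trans ?_
      · have hi := Finset.mem_range.1 hi
        gcongr
        · exact hcard i hi.le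
        · exact hcard _ hi
      · rw [Finset.card_range, smul_eq_mul]
        exact le_of_eq (by ring)
  · intro i hi
    simp only [S]
    split_ifs
    · simp
    · simp
    · exact ⟨Sum.inl 0, by simp [R]⟩
  · rintro i b (j | v) (j' | v') <;> simp only [M, Sum.elim_inl, Sum.elim_inr]
    · split_ifs <;> simp
    · simp
    · split_ifs <;> simp
    · split_ifs <;> simp
  · intro x
    simp [F, w]
  · intro x i t ht
    rw [hFS x i fun s => M i (x (e i)) s t]
    simp only [R]
    rw [Finset.sum_disjSum]
    have hw : ∑ v ∈ Finset.range (i.val + 1), F x i (Sum.inr v) * M i (x (e i)) (Sum.inr v) t =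
        M i (x (e i)) (Sum.inr (w x i)) t := by
      rw [Finset.sum_eq_single (w x i)]
      · simp [F]
      · intro v _ hv
        simp [F, Ne.symm hv]
      · intro h
        exact absurd (Finset.mem_range.2 (Nat.lt_succ_iff.2 (w_le x i))) h
    rw [hw]
    rcases t with j' | v'
    · have hj' := hSR _ ht
      simp only [R, Finset.inl_mem_disjSum, Finset.mem_range] at hj'
      have hb := Bool.toNat_le (x (e i))
      -- The bit just read is deducted from the guessed remaining weight, so only one guess leads to
      -- `j'`.
      rw [Finset.sum_eq_single (j' + (x (e i)).toNat)]
      · simp only [M, F, Sum.elim_inl, Sum.elim_inr, w_succ, if_true, mul_one, hp]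
        have hsplit : (∃ l : Fin n, l.val < i.val + 1 ∧
              (e l).val + 1 = w x i + (x (e i)).toNat + j' ∧ x (e l) = true) ↔
            (∃ l : Fin n, l.val < i.val ∧
              (e l).val + 1 = w x i + (j' + (x (e i)).toNat) ∧ x (e l) = true) ∨
            (x (e i) = true ∧ (e i).val + 1 = w x i + 1 + j') := by
          constructor
          · rintro ⟨l, h1, h2, h3⟩
            rcases (Nat.lt_succ_iff.1 h1).lt_or_eq with h | h
            · exact Or.inl ⟨l, h, by omega, h3⟩
            · obtain rfl := Fin.ext h
              refine Or.inr ⟨h3, ?_⟩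
              rw [h3] at h2
              simpa using h2
          · rintro (⟨l, h1, h2, h3⟩ | ⟨h1, h2⟩)
            · exact ⟨l, by omega, by omega, h3⟩
            · exact ⟨i, by omega, by rw [h1]; simpa using h2, h1⟩
        -- An earlier selected variable and the current one would have the same index, so the two
        -- contributions never add up to 2.
        have hdisj : ¬ ((∃ l : Fin n, l.val < i.val ∧
              (e l).val + 1 = w x i + (j' + (x (e i)).toNat) ∧ x (e l) = true) ∧
            (x (e i) = true ∧ (e i).val + 1 = w x i + 1 + j')) := by
          rintro ⟨⟨l, h1, h2, h3⟩, h4, h5⟩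
          rw [h4, Bool.toNat_true] at h2
          have : l = i := he.1 (Fin.ext (by omega))
          omega
        simp only [hsplit]
        exact ite_or_of_not_and hdisj
      · intro j _ hj
        simp [M, hj]
      · intro h
        refine absurd (Finset.mem_range.2 ?_) h
        have := i.2
        omega
    · rw [Finset.sum_eq_zero]
      · simp only [M, F, Sum.elim_inr, w_succ, zero_add, eq_comm]
      · intro j _
        simp [M]
  · intro x
    simp only [F, Sum.elim_inl, w_n, add_zero, exists_hwb_eq_iff]
    refine if_congr ?_ rfl rfl
    constructor
    · rintro ⟨l, -, h⟩
      exact ⟨e l, h⟩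
    · rintro ⟨l, h⟩
      obtain ⟨l, rfl⟩ := he.2 l
      exact ⟨l, l.2, h⟩

/-! ### Lower bound for OBDDs of HWB -/

namespace OBDD

variable {n : ℕ} {ord : VarOrder n}

theorem eval_congr_of_notMem (B : OBDD ord) {D : Finset (Fin n)}
    (hD : ∀ i j, i ∉ D → ord.lt i j → j ∉ D) {y y' : Fin n → Bool} (h : ∀ i ∉ D, y i = y' i)
    (u : B.Node ⊕ Bool) (hu : ∀ v, u = Sum.inl v → B.var v ∉ D) : B.eval y u = B.eval y' u := by
  revert hu
  refine B.node_induction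
    (P := fun u => (∀ v, u = Sum.inl v → B.var v ∉ D) → B.eval y u = B.eval y' u) ?_ ?_ u
  · simp
  · intro v ih hv
    have hv := hv v rfl
    rw [eval_inl, eval_inl _ y', ← h _ hv]
    exact ih _ fun c hc => hD _ _ hv (B.ordered v c (child_edge hc))

/-- The path of `x` leaves the set `D` of variables at a node that depends on `x` only through the
variables in `D`. -/
theorem exists_exit (B : OBDD ord) (D : Finset (Fin n)) (x : Fin n → Bool) (u : B.Node ⊕ Bool) :
    ∃ w : B.Node ⊕ Bool, (∀ v, w = Sum.inl v → B.var v ∉ D) ∧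
      ∀ y : Fin n → Bool, (∀ i ∈ D, y i = x i) → B.eval y u = B.eval y w := by
  refine B.node_induction (P := fun u => ∃ w : B.Node ⊕ Bool, (∀ v, w = Sum.inl v → B.var v ∉ D) ∧
      ∀ y : Fin n → Bool, (∀ i ∈ D, y i = x i) → B.eval y u = B.eval y w) ?_ ?_ u
  · exact fun b => ⟨Sum.inr b, by simp, fun _ _ => rfl⟩
  · intro v ih
    by_cases hv : B.var v ∈ D
    · obtain ⟨w, hw, h⟩ := ih (x (B.var v))
      refine ⟨w, hw, fun y hy => ?_⟩
      rw [eval_inl, hy _ hv, h y hy]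
    · refine ⟨Sum.inl v, ?_, fun _ _ => rfl⟩
      rintro _ ⟨⟩
      exact hv

/-- Distinct subfunctions of an initial segment `D` of the variables need distinct nodes. -/
theorem card_le_size_of_subfunctions (B : OBDD ord) {D : Finset (Fin n)}
    (hD : ∀ i j, i ∉ D → ord.lt i j → j ∉ D) {ι : Type*} (s : Finset ι)
    (p : ι → Fin n → Bool)
    (hs : ∀ a ∈ s, ∀ b ∈ s, a ≠ b →
      ∃ z : Fin n → Bool, B.fn (D.piecewise (p a) z) ≠ B.fn (D.piecewise (p b) z)) :
    s.card ≤ B.size := by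
  let _ := B.fintypeNode
  choose w hw hwe using fun a => B.exists_exit D (p a) B.root
  have : B.size = (Finset.univ : Finset (B.Node ⊕ Bool)).card := by
    simp [size]
  rw [this]
  refine Finset.card_le_card_of_injOn w (fun _ _ => Finset.mem_univ _) fun a ha b hb hab => ?_
  by_contra hne
  obtain ⟨z, hz⟩ := hs a ha b hb hne
  refine hz ?_
  have hfn : ∀ a, B.fn (D.piecewise (p a) z) = B.eval (D.piecewise (p a) z) (w a) := fun a =>
    hwe a _ fun i hi => D.piecewise_eq_of_mem _ _ hi
  rw [hfn, hfn, hab]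
  refine B.eval_congr_of_notMem hD (fun i hi => ?_) _ (hw b)
  rw [D.piecewise_eq_of_notMem _ _ hi, D.piecewise_eq_of_notMem _ _ hi]

end OBDD

theorem hwb_indicator {n : ℕ} (T : Finset (Fin n)) (i : Fin n) (hi : i.val + 1 = T.card) :
    hwb n (fun j => decide (j ∈ T)) = decide (i ∈ T) := by
  have hT : hammingWeight (fun j => decide (j ∈ T)) = T.card := by
    simp only [hammingWeight, Bool.toNat, Bool.cond_decide, Finset.sum_ite_mem, Finset.univ_inter,
      Finset.sum_const, smul_eq_mul, mul_one]
  rw [Bool.eq_iff_iff, exists_hwb_eq_iff, hT]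
  constructor
  · rintro ⟨l, hl, h⟩
    obtain rfl : l = i := Fin.ext (by omega)
    exact h
  · exact fun h => ⟨i, hi, h⟩

/-- Each `A` is padded by `E A ⊆ D \ W` to weight exactly `a`. If `A` and `A'` differ at `i ∈ W`,
setting `i + 1 - a ≤ d` variables outside `D` to one makes the total weight `i + 1`; HWB then
returns the bit at `i`, which tells the two apart. -/
theorem OBDD.card_le_size_of_hwb {n : ℕ} {ord : VarOrder n} {B : OBDD ord} (hB : B.fn = hwb n)
    {D W : Finset (Fin n)} (hD : ∀ i j, i ∉ D → ord.lt i j → j ∉ D) (hWD : W ⊆ D) {a d : ℕ}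
    (hd : d ≤ Dᶜ.card) (hW : ∀ i ∈ W, a ≤ i.val ∧ i.val < a + d) (s : Finset (Finset (Fin n)))
    (hs : ∀ A ∈ s, A ⊆ W ∧ A.card ≤ a ∧ a ≤ A.card + (D \ W).card) : s.card ≤ B.size := by
  have hext : ∀ A ∈ s, ∃ A', A' ⊆ D \ W ∧ A'.card = a - A.card := fun A hA =>
    Finset.exists_subset_card_eq (by have := hs A hA; omega)
  choose! E hED hE using hext
  refine B.card_le_size_of_subfunctions hD s (fun A i => decide (i ∈ A ∪ E A)) ?_
  rw [hB]
  intro A hA A' hA' hne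
  obtain ⟨i, hiW, hi⟩ : ∃ i ∈ W, decide (i ∈ A) ≠ decide (i ∈ A') := by
    by_contra! h
    refine hne (Finset.ext fun i => ?_)
    by_cases hiW : i ∈ W
    · simpa using h i hiW
    · exact ⟨fun hi => absurd ((hs A hA).1 hi) hiW, fun hi => absurd ((hs A' hA').1 hi) hiW⟩
  obtain ⟨Z, hZD, hZ⟩ : ∃ Z ⊆ Dᶜ, Z.card = i.val + 1 - a :=
    Finset.exists_subset_card_eq (by have := hW i hiW; omega)
  refine ⟨fun j => decide (j ∈ Z), ?_⟩
  have key : ∀ A ∈ s, hwb n (D.piecewise (fun j => decide (j ∈ A ∪ E A)) fun j => decide (j ∈ Z)) =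
      decide (i ∈ A) := by
    intro A hA
    obtain ⟨hAW, hAa, -⟩ := hs A hA
    have hEW : ∀ j ∈ E A, j ∈ D ∧ j ∉ W := fun j hj => Finset.mem_sdiff.1 (hED A hA hj)
    have hZ' : ∀ j ∈ Z, j ∉ D := fun j hj => Finset.mem_compl.1 (hZD hj)
    have hfun : D.piecewise (fun j => decide (j ∈ A ∪ E A)) (fun j => decide (j ∈ Z)) =
        fun j => decide (j ∈ A ∪ E A ∪ Z) := by
      funext j
      by_cases hj : j ∈ D
      · rw [D.piecewise_eq_of_mem _ _ hj]
        have : j ∉ Z := fun h => hZ' j h hj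
        simp [this]
      · rw [D.piecewise_eq_of_notMem _ _ hj]
        have h1 : j ∉ A := fun h => hj (hWD (hAW h))
        have h2 : j ∉ E A := fun h => hj (hEW j h).1
        simp [h1, h2]
    have hcard : (A ∪ E A ∪ Z).card = i.val + 1 := by
      rw [Finset.card_union_of_disjoint, Finset.card_union_of_disjoint, hE A hA, hZ]
      · have := hW i hiW
        omega
      · rw [Finset.disjoint_left]
        exact fun j hj hj' => (hEW j hj').2 (hAW hj)
      · rw [Finset.disjoint_left]
        intro j hj hj'
        refine hZ' j hj' ?_
        rcases Finset.mem_union.1 hj with hj | hj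
        · exact hWD (hAW hj)
        · exact (hEW j hj).1
    rw [hfun, hwb_indicator _ i hcard.symm]
    have h1 : i ∉ E A := fun h => (hEW i h).2 hiW
    have h2 : i ∉ Z := fun h => hZ' i h (hWD hiW)
    simp [h1, h2]
  rw [key A hA, key A' hA']
  exact hi

/-- Complementation in `W` exchanges the two families, and together they cover the power set. -/
theorem two_pow_le_two_mul_card_filter {α : Type*} [DecidableEq α] {W : Finset α} {m : ℕ}
    (hW : W.card = 2 * m) :
    2 ^ (2 * m) ≤ 2 * (W.powerset.filter fun A => A.card ≤ m).card ∧
      2 ^ (2 * m) ≤ 2 * (W.powerset.filter fun A => m ≤ A.card).card := by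
  have hcompl : ∀ A ∈ W.powerset, (W \ A).card = 2 * m - A.card := fun A hA => by
    rw [Finset.card_sdiff_of_subset (Finset.mem_powerset.1 hA), hW]
  have heq : (W.powerset.filter fun A => A.card ≤ m).card =
      (W.powerset.filter fun A => m ≤ A.card).card := by
    refine Finset.card_nbij' (fun A => W \ A) (fun A => W \ A) ?_ ?_ ?_ ?_
    · intro A hA
      simp only [Finset.coe_filter, Set.mem_ofPred_eq] at hA ⊢
      refine ⟨Finset.mem_powerset.2 Finset.sdiff_subset, ?_⟩
      rw [hcompl A hA.1]
      omega
    · intro A hA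
      simp only [Finset.coe_filter, Set.mem_ofPred_eq] at hA ⊢
      refine ⟨Finset.mem_powerset.2 Finset.sdiff_subset, ?_⟩
      rw [hcompl A hA.1]
      omega
    · intro A hA
      simp only [Finset.coe_filter, Set.mem_ofPred_eq, Finset.mem_powerset] at hA
      exact Finset.sdiff_sdiff_eq_self hA.1
    · intro A hA
      simp only [Finset.coe_filter, Set.mem_ofPred_eq, Finset.mem_powerset] at hA
      exact Finset.sdiff_sdiff_eq_self hA.1
  have hunion : W.powerset ⊆ (W.powerset.filter fun A => A.card ≤ m) ∪
      (W.powerset.filter fun A => m ≤ A.card) := by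
    intro A hA
    simp only [Finset.mem_union, Finset.mem_filter, hA, true_and]
    exact le_total _ _
  have hle := (Finset.card_le_card hunion).trans (Finset.card_union_le _ _)
  rw [Finset.card_powerset, hW] at hle
  omega

theorem card_filter_val {n : ℕ} {a b : ℕ} (hb : b ≤ n) :
    (Finset.univ.filter fun i : Fin n => a ≤ i.val ∧ i.val < b).card = b - a := by
  rw [← Nat.card_Ico, ← Finset.card_map Fin.valEmbedding]
  congr 1
  ext l
  simp only [Finset.mem_map, Finset.mem_filter, Finset.mem_univ, true_and, Fin.valEmbedding_apply,
    Finset.mem_Ico]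
  exact ⟨fun ⟨i, h, hi⟩ => hi ▸ h, fun h => ⟨⟨l, by omega⟩, h, rfl⟩⟩

/-- With `m = n / 10`, let `D` be all but the last `4 * m` variables of the order. The position
windows `[m, 5m)` and `[5m, 9m)` have `8 * m` elements together, of which at most `4 * m` lie
outside `D`, so one of them has at least `2 * m` in `D`. -/
theorem OBDD.two_pow_le_of_hwb {n : ℕ} {ord : VarOrder n} {B : OBDD ord} (hB : B.fn = hwb n) :
    2 ^ (2 * (n / 10)) ≤ 2 * B.size := by
  obtain ⟨e, he, hlt⟩ := ord.exists_enum_univ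
  obtain ⟨m, hm⟩ : ∃ m, m = n / 10 := ⟨_, rfl⟩
  rw [← hm]
  have hmn : 10 * m ≤ n := by omega
  let D : Finset (Fin n) := (Finset.univ.filter fun i : Fin n => 0 ≤ i.val ∧ i.val < n - 4 * m).map
    ⟨e, he.1⟩
  have hmemD : ∀ i, e i ∈ D ↔ i.val < n - 4 * m := by
    intro i
    simp [D]
  have hDcard : D.card = n - 4 * m := by
    rw [Finset.card_map, card_filter_val (by omega), Nat.sub_zero]
  have hDc : Dᶜ.card = 4 * m := by
    rw [Finset.card_compl, hDcard, Fintype.card_fin]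
    omega
  have hD : ∀ i j, i ∉ D → ord.lt i j → j ∉ D := by
    intro i j
    obtain ⟨i, rfl⟩ := he.2 i
    obtain ⟨j, rfl⟩ := he.2 j
    rw [hmemD, hmemD, hlt, Fin.lt_def]
    omega
  let X : ℕ → Finset (Fin n) := fun a => Finset.univ.filter fun i => a ≤ i.val ∧ i.val < a + 4 * m
  have hX : ∀ a, a ≤ 5 * m → (X a).card = 4 * m := by
    intro a ha
    rw [card_filter_val (by omega)]
    omega
  have hsum : 4 * m ≤ (D ∩ X m).card + (D ∩ X (5 * m)).card := by
    have hdisj : Disjoint (X m) (X (5 * m)) := by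
      rw [Finset.disjoint_left]
      intro i hi hi'
      simp only [X, Finset.mem_filter, Finset.mem_univ, true_and] at hi hi'
      omega
    have h1 : (X m ∪ X (5 * m)).card = 8 * m := by
      rw [Finset.card_union_of_disjoint hdisj, hX _ (by omega), hX _ le_rfl]
      omega
    have h2 : X m ∪ X (5 * m) ⊆ (D ∩ X m ∪ D ∩ X (5 * m)) ∪ Dᶜ := by
      intro i hi
      simp only [Finset.mem_union, Finset.mem_inter, Finset.mem_compl] at hi ⊢
      tauto
    have h3 := (Finset.card_le_card h2).trans (Finset.card_union_le _ _)
    have h4 := Finset.card_union_le (D ∩ X m) (D ∩ X (5 * m))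
    omega
  -- `Q` selects the patterns on `W` that can be padded to weight `a`: there are at least `4 * m`
  -- padding variables, so those of size at most `m` work for `a = m`, and those of size at least
  -- `m` for `a = 5 * m`. Either way half of the `2 ^ (2 * m)` subsets remain.
  have key : ∀ (a : ℕ) (Q : ℕ → Prop) [DecidablePred Q], 2 * m ≤ (D ∩ X a).card →
      (∀ W : Finset (Fin n), W.card = 2 * m →
        2 ^ (2 * m) ≤ 2 * (W.powerset.filter fun A => Q A.card).card) →
      (∀ c, c ≤ 2 * m → Q c → c ≤ a ∧ a ≤ c + 4 * m) → 2 ^ (2 * m) ≤ 2 * B.size := by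
    intro a Q _ h1 h2 h3
    obtain ⟨W, hW, hWcard⟩ := Finset.exists_subset_card_eq h1
    have hWD : W ⊆ D := hW.trans Finset.inter_subset_left
    refine (h2 W hWcard).trans (Nat.mul_le_mul_left 2 ?_)
    refine OBDD.card_le_size_of_hwb hB hD hWD (a := a) (d := 4 * m) hDc.ge (fun i hi => ?_) _ ?_
    · have := Finset.inter_subset_right (hW hi)
      simpa [X] using this
    · intro A hA
      rw [Finset.mem_filter, Finset.mem_powerset] at hA
      have hle := Finset.card_le_card hA.1
      have := h3 A.card (by omega) hA.2
      refine ⟨hA.1, this.1, ?_⟩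
      rw [Finset.card_sdiff_of_subset hWD, hDcard, hWcard]
      omega
  by_cases h : 2 * m ≤ (D ∩ X m).card
  · exact key m (· ≤ m) h (fun W hW => (two_pow_le_two_mul_card_filter hW).1) (by omega)
  · exact key (5 * m) (m ≤ ·) (by omega) (fun W hW => (two_pow_le_two_mul_card_filter hW).2)
      (by omega)

theorem OBDD.rpow_le_of_hwb {n : ℕ} {ord : VarOrder n} {B : OBDD ord} (hB : B.fn = hwb n) :
    1 / 8 * (2 : ℝ) ^ ((n : ℝ) / 5) ≤ (B.size : ℝ) := by
  have h : (2 : ℝ) ^ (2 * (n / 10)) ≤ 2 * B.size := by exact_mod_cast OBDD.two_pow_le_of_hwb hB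
  have hn : (n : ℝ) ≤ 10 * (n / 10 : ℕ) + 10 := by exact_mod_cast (by omega : n ≤ 10 * (n / 10) + 10)
  -- Rounding `n / 10` down costs a factor of at most 4, and the halving above another 2, whence `1
  -- / 8`.
  have h2 : (2 : ℝ) ^ ((n : ℝ) / 5) ≤ (2 : ℝ) ^ (2 * (n / 10) + 2) := by
    rw [← Real.rpow_natCast]
    refine Real.rpow_le_rpow_of_exponent_le one_le_two ?_
    push_cast
    linarith
  rw [pow_add] at h2
  linarith

/-! ### Separation of the two classes -/

/-- An exponential function is not dominated by a polynomial. -/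
theorem exists_polynomial_lt_rpow (q : Polynomial ℝ) {c : ℝ} (hc : 0 < c) :
    ∃ n : ℕ, 1 ≤ n ∧ q.eval (n : ℝ) < c * (2 : ℝ) ^ ((n : ℝ) / 5) := by
  have hlog : 0 < Real.log 2 / 5 := div_pos (Real.log_pos one_lt_two) (by norm_num)
  -- Substituting `t = n * (log 2 / 5)` turns `2 ^ (n / 5)` into `exp t`, so `q` is rescaled
  -- accordingly.
  have h := (q.comp (Polynomial.C (Real.log 2 / 5)⁻¹ * Polynomial.X)).tendsto_div_exp_atTop
  have h' := h.comp (tendsto_natCast_atTop_atTop.const_mul_atTop hlog)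
  obtain ⟨n, hn1, hn⟩ := ((Filter.eventually_ge_atTop 1).and (h'.eventually_lt_const hc)).exists
  refine ⟨n, hn1, ?_⟩
  simp only [Function.comp_apply, Polynomial.eval_comp, Polynomial.eval_mul, Polynomial.eval_C,
    Polynomial.eval_X] at hn
  rw [div_lt_iff₀ (Real.exp_pos _), ← mul_assoc, inv_mul_cancel₀ hlog.ne', one_mul] at hn
  rwa [Real.rpow_def_of_pos two_pos, mul_div_assoc', mul_div_right_comm]

theorem ttClass_moreSuccinct (ord : ∀ n, VarOrder n) :
    RepClass.MoreSuccinct (ttClass ord) (obddClass ord) := by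
  constructor
  -- Smoothing at most squares the size, because there are fewer labels than nodes, and passing to a
  -- tensor train squares it again.
  · refine ⟨Polynomial.X ^ 4, fun n hn B => ?_⟩
    obtain ⟨L, hL, hfn, hsize⟩ := OBDD.exists_levelwiseSmooth (ord := ord n) B
    obtain ⟨T, hT, hTsize⟩ := L.exists_ttRep_of_isLevelwiseSmooth hn hL
    refine ⟨T, hT.trans hfn, ?_⟩
    have hB := OBDD.labels_ncard_le (ord := ord n) B
    have hmax : max 1 (OBDD.labels (ord := ord n) B).ncard ≤ OBDD.size (ord := ord n) B :=
      max_le (by omega) (by omega)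
    simp only [Polynomial.eval_pow, Polynomial.eval_X]
    calc T.size ≤ L.size ^ 2 := hTsize
      _ ≤ (OBDD.size (ord := ord n) B * OBDD.size (ord := ord n) B) ^ 2 :=
        Nat.pow_le_pow_left (hsize.trans (Nat.mul_le_mul_left _ hmax)) 2
      _ = OBDD.size (ord := ord n) B ^ 4 := by ring
  · rintro ⟨p, hp⟩
    obtain ⟨n, hn, hlt⟩ := exists_polynomial_lt_rpow
      ((p.comp (8 * Polynomial.X ^ 3)).map (Nat.castRingHom ℝ)) (c := 1 / 8) (by norm_num)
    obtain ⟨T, hT, -, hsize⟩ := exists_ttRep_hwb (ord n) hn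
    obtain ⟨B, hB, hBsize⟩ := hp n hn T
    refine absurd hlt (not_lt.2 ((OBDD.rpow_le_of_hwb (ord := ord n) (hB.trans hT)).trans ?_))
    rw [Polynomial.eval_natCast_map]
    -- Natural coefficients make `p` monotone.
    have hmono : p.eval T.size ≤ p.eval (8 * n ^ 3) := by
      rw [Polynomial.eval_eq_sum, Polynomial.eval_eq_sum]
      exact Finset.sum_le_sum fun i _ => Nat.mul_le_mul_left _ (Nat.pow_le_pow_left hsize i)
    have : OBDD.size (ord := ord n) B ≤ p.eval (8 * n ^ 3) := hBsize.trans hmono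
    simpa using (Nat.cast_le (α := ℝ)).2 this

theorem mainTheorem1 :
    -- `TT_<` is more succinct than `OBDD_<`
    (∀ ord : ∀ n, VarOrder n, RepClass.MoreSuccinct (ttClass ord) (obddClass ord)) ∧
    -- every OBDD is equivalent to a level-wise smooth OBDD of polynomial size
    (∀ (n : ℕ) (ord : VarOrder n) (B : OBDD ord),
      ∃ L : OBDD ord, L.IsLevelwiseSmooth B.labels ∧ L.fn = B.fn ∧
        L.size ≤ B.size * max 1 B.labels.ncard) ∧
    -- every level-wise smooth OBDD is equivalent to a tensor train of at most quadratic size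
    (∀ (n : ℕ) (ord : VarOrder n) (V : Set (Fin n)) (L : OBDD ord), 1 ≤ n →
      L.IsLevelwiseSmooth V → ∃ T : TTRep ord, T.fn = L.fn ∧ T.size ≤ L.size ^ 2) ∧
    -- tensor trains for the hidden weighted bit functions
    (∀ (n : ℕ) (ord : VarOrder n), 1 ≤ n →
      ∃ T : TTRep ord, T.fn = hwb n ∧ T.train.rank ≤ 2 * n ∧ T.size ≤ 8 * n ^ 3) ∧
    -- exponential lower bound for the OBDD size of the hidden weighted bit functions
    (∃ c : ℝ, 0 < c ∧ ∀ (n : ℕ) (ord : VarOrder n) (B : OBDD ord), B.fn = hwb n →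
      c * (2 : ℝ) ^ ((n : ℝ) / 5) ≤ (B.size : ℝ)) := by
  exact ⟨ttClass_moreSuccinct, fun _ _ B => B.exists_levelwiseSmooth,
    fun _ _ _ L hn hL => L.exists_ttRep_of_isLevelwiseSmooth hn hL,
    fun _ ord hn => exists_ttRep_hwb ord hn,
    1 / 8, by norm_num, fun _ _ _ hB => OBDD.rpow_le_of_hwb hB⟩
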